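/- Let $p$ be a prime. For each integer $m \ge 1$ let $\mathbb{F}_{p^m}$ be the finite field with $p^m$ elements, let $\mathrm{tr}(x) = x + x^p + \cdots + x^{p^{m-1}} \in \mathbb{F}_p$ be the trace of $x \in \mathbb{F}_{p^m}$ over $\mathbb{F}_p$, and call $\mathrm{tr}(x^{-1})$ the co-trace of $x \ne 0$. For $i, j \in \mathbb{F}_p$ let $$T_{ij} = T_{ij}^{(m)} = \left|\{x \in \mathbb{F}_{p^m}^{*} : \mathrm{tr}(x) = i,\ \mathrm{tr}(x^{-1}) = j\}\right|$$ be the number of non-zero elements with trace $i$ and co-trace $j$. Then, for fixed $p$, $$\lim_{m \to \infty} \frac{T_{00}^{(m)}}{p^m} = \frac{1}{p^2} \qquad\text{and}\qquad \lim_{m \to \infty} \frac{T_{01}^{(m)}}{p^m} = \frac{1}{p^2}.$$ -/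

import Mathlib

open Filter Topology

/-- The co-trace over `𝔽_p` of an element `x` of a field `K` of characteristic `p`:
the trace of its inverse. It is only used at `x ≠ 0`. -/
noncomputable def coTrace (p : ℕ) [Fact p.Prime] {K : Type*} [Field K] [Algebra (ZMod p) K]
    (x : K) : ZMod p :=
  Algebra.trace (ZMod p) K x⁻¹

/-- `T_{ij}` for the field `K`: the number of non-zero elements of `K` whose trace over `𝔽_p`
is `i` and whose co-trace is `j`. -/
noncomputable def traceCoTraceCount (p : ℕ) [Fact p.Prime] (K : Type*) [Field K]
    [Algebra (ZMod p) K] (i j : ZMod p) : ℕ :=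
  {x : K | x ≠ 0 ∧ Algebra.trace (ZMod p) K x = i ∧ coTrace p x = j}.ncard

/-- On a field with `p ^ m` elements the trace is `x + x ^ p + ⋯ + x ^ (p ^ (m - 1))`. -/
theorem algebraMap_trace_eq_sum_frobenius (p : ℕ) [Fact p.Prime] (m : ℕ) (K : Type*) [Field K]
    [Algebra (ZMod p) K] (hK : Nat.card K = p ^ m) (x : K) :
    algebraMap (ZMod p) K (Algebra.trace (ZMod p) K x) = ∑ k ∈ Finset.range m, x ^ (p ^ k) := by
  have hp : p.Prime := Fact.out
  have : Finite K := Nat.finite_of_card_ne_zero (by rw [hK]; exact pow_ne_zero _ hp.ne_zero)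
  have h := Module.natCard_eq_pow_finrank (K := ZMod p) (V := K)
  rw [hK, Nat.card_zmod] at h
  have hm : m = Module.finrank (ZMod p) K := Nat.pow_right_injective hp.two_le h
  rw [FiniteField.algebraMap_trace_eq_sum_pow, Nat.card_zmod, hm]

/-! Detecting both trace conditions by additive characters of `𝔽_p` writes `p² T_ij` as a sum of
`p²` Kloosterman sums over the field of `q = p^m` elements, with coefficients of modulus 1. The term
at `(0, 0)` is `q - 1`; it remains to see that every other term is `o(q)`. Kloosterman's
fourth-moment bound `O(q^(3/4))` suffices, so Weil's bound is not needed. The fourth moment over all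
`(a, b)` is `q²` times the number of unit solutions of `x + y = z + w`, `x⁻¹ + y⁻¹ = z⁻¹ + w⁻¹`,
which is at most `3(q - 1)²`. Each nonzero `(a, b)` shares its sum with `q - 1` pairs, so `(q -
1)|S|⁴ ≤ 3q²(q - 1)²`. -/

/-- The Kloosterman sum attached to an additive character. -/
noncomputable def kloostermanSum {K : Type*} [Field K] [Fintype K] (ψ : AddChar K ℂ) (a b : K) : ℂ :=
  open Classical in ∑ x : Kˣ, ψ (a * x + b * ((x⁻¹ : Kˣ) : K))

/-- Eliminating `w = x + y - z` turns the second equation into `(x + y)(z - x)(z - y) = 0`, one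
factor per case. -/
theorem units_add_eq_add_inv_add_eq_add {K : Type*} [Field K] {x y z w : Kˣ}
    (h₁ : (x + y : K) = z + w) (h₂ : ((x⁻¹ : Kˣ) + (y⁻¹ : Kˣ) : K) = (z⁻¹ : Kˣ) + (w⁻¹ : Kˣ)) :
    (y = -x ∧ w = -z) ∨ (z = x ∧ w = y) ∨ (z = y ∧ w = x) := by
  simp only [Units.ext_iff, Units.val_neg]
  simp only [Units.val_inv_eq_inv_val] at h₂
  have hx := x.ne_zero
  have hy := y.ne_zero
  have hz := z.ne_zero
  have hw := w.ne_zero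
  generalize (x : K) = x at *
  generalize (y : K) = y at *
  generalize (z : K) = z at *
  generalize (w : K) = w at *
  field_simp at h₂
  have hw' : w = x + y - z := by linear_combination -h₁
  have h : (x + y) * ((z - x) * (z - y)) = 0 := by
    rw [hw'] at h₂
    linear_combination -h₂
  rcases mul_eq_zero.1 h with h | h
  · left
    exact ⟨by linear_combination h, by rw [hw']; linear_combination h⟩
  · rcases mul_eq_zero.1 h with h | h
    · right; left
      exact ⟨by linear_combination h, by rw [hw']; linear_combination -h⟩
    · right; right
      exact ⟨by linear_combination h, by rw [hw']; linear_combination -h⟩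

/-! ### Fourth moment of Kloosterman sums -/

section Moments

open Classical

variable {K : Type*} [Field K] [Fintype K]

/-- Orthogonality of characters in two variables. -/
theorem AddChar.sum_sum_mul_add_mul {ψ : AddChar K ℂ} (hψ : ψ.IsPrimitive) (u v : K) :
    ∑ a : K, ∑ b : K, ψ (a * u + b * v) =
      if u = 0 ∧ v = 0 then (Fintype.card K : ℂ) ^ 2 else 0 := by
  simp_rw [AddChar.map_add_eq_mul, ← Finset.mul_sum, ← Finset.sum_mul,
    AddChar.sum_mulShift _ hψ]
  by_cases hu : u = 0 <;> by_cases hv : v = 0 <;> simp [hu, hv, sq]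

/-- The second moment of a two-parameter exponential sum counts coincidences. -/
theorem sum_sum_norm_sq_expSum {ψ : AddChar K ℂ} (hψ : ψ.IsPrimitive) {ι : Type*} [Fintype ι]
    (f g : ι → K) :
    ∑ a : K, ∑ b : K, ‖∑ i, ψ (a * f i + b * g i)‖ ^ 2 =
      (Fintype.card K : ℝ) ^ 2 *
        (Finset.univ.filter fun s : ι × ι => f s.1 = f s.2 ∧ g s.1 = g s.2).card := by
  have key : ∀ a b : K, ((‖∑ i, ψ (a * f i + b * g i)‖ ^ 2 : ℝ) : ℂ) =
      ∑ s : ι × ι, ψ (a * (f s.1 - f s.2) + b * (g s.1 - g s.2)) := by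
    intro a b
    rw [Complex.ofReal_pow, ← Complex.mul_conj', map_sum, Finset.sum_mul_sum,
      Fintype.sum_prod_type]
    refine Finset.sum_congr rfl fun i _ => Finset.sum_congr rfl fun j _ => ?_
    rw [← AddChar.map_neg_eq_conj, ← AddChar.map_add_eq_mul]
    congr 1
    ring
  have h : ((∑ a : K, ∑ b : K, ‖∑ i, ψ (a * f i + b * g i)‖ ^ 2 : ℝ) : ℂ) =
      (Fintype.card K : ℂ) ^ 2 *
        (Finset.univ.filter fun s : ι × ι => f s.1 = f s.2 ∧ g s.1 = g s.2).card := by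
    rw [Complex.ofReal_sum]
    simp_rw [Complex.ofReal_sum, key]
    simp_rw [Finset.sum_comm (s := Finset.univ (α := K)) (t := Finset.univ (α := ι × ι))]
    simp_rw [AddChar.sum_sum_mul_add_mul hψ, sub_eq_zero]
    rw [← Finset.sum_filter, Finset.sum_const, nsmul_eq_mul, mul_comm]
  exact_mod_cast h

/-- Each of the three solution families is parametrized by two units. -/
theorem card_units_coincidences_le :
    (Finset.univ.filter fun s : (Kˣ × Kˣ) × (Kˣ × Kˣ) =>
      (s.1.1 + s.1.2 : K) = s.2.1 + s.2.2 ∧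
      ((s.1.1⁻¹ : Kˣ) + (s.1.2⁻¹ : Kˣ) : K) = (s.2.1⁻¹ : Kˣ) + (s.2.2⁻¹ : Kˣ)).card ≤
      3 * Fintype.card Kˣ ^ 2 := by
  let U : Finset (Kˣ × Kˣ) := Finset.univ
  have hU : U.card = Fintype.card Kˣ ^ 2 := by
    rw [Finset.card_univ, Fintype.card_prod, sq]
  have hsub : (Finset.univ.filter fun s : (Kˣ × Kˣ) × (Kˣ × Kˣ) =>
      (s.1.1 + s.1.2 : K) = s.2.1 + s.2.2 ∧
      ((s.1.1⁻¹ : Kˣ) + (s.1.2⁻¹ : Kˣ) : K) = (s.2.1⁻¹ : Kˣ) + (s.2.2⁻¹ : Kˣ)) ⊆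
      U.image (fun t => ((t.1, -t.1), (t.2, -t.2))) ∪
        (U.image (fun t => (t, t)) ∪ U.image (fun t => (t, (t.2, t.1)))) := by
    rintro ⟨⟨x, y⟩, ⟨z, w⟩⟩ hs
    obtain ⟨h₁, h₂⟩ := (Finset.mem_filter.1 hs).2
    simp only [Finset.mem_union, Finset.mem_image]
    have h := units_add_eq_add_inv_add_eq_add h₁ h₂
    dsimp only at h
    rcases h with ⟨rfl, rfl⟩ | ⟨rfl, rfl⟩ | ⟨rfl, rfl⟩
    · exact Or.inl ⟨(x, z), Finset.mem_univ _, rfl⟩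
    · exact Or.inr (Or.inl ⟨(z, w), Finset.mem_univ _, rfl⟩)
    · exact Or.inr (Or.inr ⟨(w, z), Finset.mem_univ _, rfl⟩)
  refine (Finset.card_le_card hsub).trans ((Finset.card_union_le _ _).trans ?_)
  rw [show 3 * Fintype.card Kˣ ^ 2 = U.card + (U.card + U.card) by rw [hU]; ring]
  exact add_le_add Finset.card_image_le ((Finset.card_union_le _ _).trans
    (add_le_add Finset.card_image_le Finset.card_image_le))

theorem sum_sum_norm_kloostermanSum_pow_four_le {ψ : AddChar K ℂ} (hψ : ψ.IsPrimitive) :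
    ∑ a : K, ∑ b : K, ‖kloostermanSum ψ a b‖ ^ 4 ≤
      (Fintype.card K : ℝ) ^ 2 * (3 * (Fintype.card Kˣ : ℝ) ^ 2) := by
  have h : ∀ a b : K, ‖kloostermanSum ψ a b‖ ^ 4 = ‖∑ s : Kˣ × Kˣ, ψ (a * (s.1 + s.2 : K) +
      b * ((s.1⁻¹ : Kˣ) + (s.2⁻¹ : Kˣ) : K))‖ ^ 2 := by
    intro a b
    rw [show ‖kloostermanSum ψ a b‖ ^ 4 = ‖kloostermanSum ψ a b * kloostermanSum ψ a b‖ ^ 2 by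
      rw [norm_mul]; ring, kloostermanSum, Finset.sum_mul_sum, Fintype.sum_prod_type]
    congr 2
    refine Finset.sum_congr rfl fun x _ => Finset.sum_congr rfl fun y _ => ?_
    rw [← AddChar.map_add_eq_mul]
    congr 1
    ring
  simp_rw [h]
  rw [sum_sum_norm_sq_expSum hψ]
  gcongr
  exact_mod_cast card_units_coincidences_le (K := K)

theorem kloostermanSum_mul_unit (ψ : AddChar K ℂ) (a b : K) (t : Kˣ) :
    kloostermanSum ψ (a * t) (b * (t⁻¹ : Kˣ)) = kloostermanSum ψ a b := by
  unfold kloostermanSum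
  refine Fintype.sum_equiv (Equiv.mulLeft t) _ _ fun x => ?_
  simp only [Equiv.coe_mulLeft, mul_inv, Units.val_mul]
  congr 1
  ring

/-- Kloosterman's elementary bound. -/
theorem norm_kloostermanSum_pow_four_le {ψ : AddChar K ℂ} (hψ : ψ.IsPrimitive) {a b : K}
    (hab : ¬(a = 0 ∧ b = 0)) :
    ‖kloostermanSum ψ a b‖ ^ 4 ≤ 3 * (Fintype.card K : ℝ) ^ 3 := by
  -- The orbit of `(a, b)` under the substitution `x ↦ t * x`: its members are distinct and
  -- contribute equally to the fourth moment.
  let e : Kˣ → K × K := fun t => (a * t, b * (t⁻¹ : Kˣ))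
  have he : Function.Injective e := by
    intro s t hst
    obtain ⟨h₁, h₂⟩ := Prod.ext_iff.1 hst
    by_cases ha : a = 0
    · exact inv_injective (Units.ext (mul_left_cancel₀ (fun hb => hab ⟨ha, hb⟩) h₂))
    · exact Units.ext (mul_left_cancel₀ ha h₁)
  have h₁ : (Fintype.card Kˣ : ℝ) * ‖kloostermanSum ψ a b‖ ^ 4 ≤
      (Fintype.card K : ℝ) ^ 2 * (3 * (Fintype.card Kˣ : ℝ) ^ 2) := by
    refine le_trans ?_ (sum_sum_norm_kloostermanSum_pow_four_le hψ)
    rw [← Fintype.sum_prod_type' (f := fun a b => ‖kloostermanSum ψ a b‖ ^ 4)]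
    calc (Fintype.card Kˣ : ℝ) * ‖kloostermanSum ψ a b‖ ^ 4
        = ∑ t : Kˣ, ‖kloostermanSum ψ (e t).1 (e t).2‖ ^ 4 := by
          simp_rw [e, kloostermanSum_mul_unit]
          rw [Finset.sum_const, nsmul_eq_mul, Finset.card_univ]
      _ = ∑ x ∈ Finset.univ.image e, ‖kloostermanSum ψ x.1 x.2‖ ^ 4 :=
          (Finset.sum_image (f := fun x : K × K => ‖kloostermanSum ψ x.1 x.2‖ ^ 4)
            fun _ _ _ _ h => he h).symm
      _ ≤ _ := Finset.sum_le_sum_of_subset_of_nonneg (Finset.subset_univ _)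
          fun _ _ _ => by positivity
  have hpos : (0 : ℝ) < Fintype.card Kˣ := by exact_mod_cast Fintype.card_pos
  have hle : (Fintype.card Kˣ : ℝ) ≤ Fintype.card K := by
    exact_mod_cast Fintype.card_le_of_injective _ Units.val_injective
  have h₂ : ‖kloostermanSum ψ a b‖ ^ 4 ≤
      (Fintype.card K : ℝ) ^ 2 * (3 * (Fintype.card Kˣ : ℝ)) :=
    le_of_mul_le_mul_left (h₁.trans_eq (by ring)) hpos
  calc _ ≤ _ := h₂
    _ ≤ (Fintype.card K : ℝ) ^ 2 * (3 * (Fintype.card K : ℝ)) := by gcongr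
    _ = _ := by ring

theorem kloostermanSum_zero_zero (ψ : AddChar K ℂ) :
    kloostermanSum ψ 0 0 = (Fintype.card K : ℂ) - 1 := by
  simp [kloostermanSum, Fintype.card_units, Nat.cast_sub Fintype.card_pos]

end Moments

/-! ### Counting by trace and co-trace -/

section TraceCount

open Classical

variable (p : ℕ) [Fact p.Prime] (K : Type*) [Field K] [Algebra (ZMod p) K]

/-- The additive character `x ↦ χ (tr x)`. -/
noncomputable def traceAddChar (χ : AddChar (ZMod p) ℂ) : AddChar K ℂ :=
  χ.compAddMonoidHom (Algebra.trace (ZMod p) K).toAddMonoidHom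

theorem traceAddChar_apply (χ : AddChar (ZMod p) ℂ) (x : K) :
    traceAddChar p K χ x = χ (Algebra.trace (ZMod p) K x) := rfl

theorem traceAddChar_isPrimitive [Finite K] {χ : AddChar (ZMod p) ℂ} (hχ : χ ≠ 1) :
    (traceAddChar p K χ).IsPrimitive := by
  refine AddChar.IsPrimitive.of_ne_one ?_
  obtain ⟨c, hc⟩ := AddChar.ne_one_iff.1 hχ
  obtain ⟨x, hx⟩ := Algebra.trace_surjective (ZMod p) K c
  exact AddChar.ne_one_iff.2 ⟨x, by rwa [traceAddChar_apply, hx]⟩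

/-- Orthogonality on `𝔽_p` detects both conditions; linearity of the trace merges `a tr x + b tr
x⁻¹` into `tr (a x + b x⁻¹)`. -/
theorem traceCoTraceCount_eq_sum_kloostermanSum [Fintype K] {χ : AddChar (ZMod p) ℂ}
    (hχ : χ ≠ 1) (i j : ZMod p) :
    (p : ℂ) ^ 2 * traceCoTraceCount p K i j = ∑ a : ZMod p, ∑ b : ZMod p,
      χ (-(a * i + b * j)) * kloostermanSum (traceAddChar p K χ)
        (algebraMap (ZMod p) K a) (algebraMap (ZMod p) K b) := by
  have hcount : traceCoTraceCount p K i j = (Finset.univ.filter fun x : Kˣ =>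
      Algebra.trace (ZMod p) K x = i ∧ Algebra.trace (ZMod p) K (x⁻¹ : Kˣ) = j).card := by
    rw [traceCoTraceCount, ← Set.ncard_coe_finset,
      ← Set.ncard_image_of_injective _ (Units.val_injective (α := K))]
    congr 1
    ext x
    simp only [Set.mem_ofPred_eq, Set.mem_image, Finset.coe_filter, Finset.mem_univ, true_and,
      coTrace]
    constructor
    · rintro ⟨hx, h₁, h₂⟩
      exact ⟨Units.mk0 x hx, ⟨h₁, by simpa using h₂⟩, rfl⟩
    · rintro ⟨u, ⟨h₁, h₂⟩, rfl⟩
      exact ⟨u.ne_zero, h₁, by simpa using h₂⟩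
  have hterm : ∀ a b : ZMod p, χ (-(a * i + b * j)) * kloostermanSum (traceAddChar p K χ)
        (algebraMap (ZMod p) K a) (algebraMap (ZMod p) K b) =
      ∑ x : Kˣ, χ (a * (Algebra.trace (ZMod p) K x - i) +
        b * (Algebra.trace (ZMod p) K (x⁻¹ : Kˣ) - j)) := by
    intro a b
    rw [kloostermanSum, Finset.mul_sum]
    refine Finset.sum_congr rfl fun x _ => ?_
    rw [traceAddChar_apply, ← AddChar.map_add_eq_mul, ← Algebra.smul_def, ← Algebra.smul_def,
      map_add (Algebra.trace (ZMod p) K), map_smul, map_smul, smul_eq_mul, smul_eq_mul]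
    congr 1
    ring
  simp_rw [hterm, Finset.sum_comm (s := Finset.univ (α := ZMod p)) (t := Finset.univ (α := Kˣ)),
    AddChar.sum_sum_mul_add_mul (AddChar.IsPrimitive.of_ne_one hχ), sub_eq_zero]
  rw [← Finset.sum_filter, Finset.sum_const, nsmul_eq_mul, ← hcount, ZMod.card, mul_comm]

theorem exists_addChar_zmod_ne_one : ∃ χ : AddChar (ZMod p) ℂ, χ ≠ 1 := by
  obtain ⟨χ, hχ⟩ := AddChar.exists_apply_ne_zero.2 (one_ne_zero (α := ZMod p))
  exact ⟨χ, AddChar.ne_one_iff.2 ⟨1, hχ⟩⟩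

/-- The elements of given trace and co-trace are equidistributed, with an explicit error term. -/
theorem abs_traceCoTraceCount_sub_pow_four_le [Fintype K] (i j : ZMod p) :
    |(p : ℝ) ^ 2 * traceCoTraceCount p K i j - ((Fintype.card K : ℝ) - 1)| ^ 4 ≤
      (p : ℝ) ^ 8 * (3 * (Fintype.card K : ℝ) ^ 3) := by
  obtain ⟨χ, hχ⟩ := exists_addChar_zmod_ne_one p
  -- Taking the fourth root lets the triangle inequality run over at most `p²` terms; the fourth
  -- power then yields `p⁸`.
  set M : ℝ := (3 * (Fintype.card K : ℝ) ^ 3) ^ (1 / 4 : ℝ) with hM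
  have hM0 : 0 ≤ M := by positivity
  have hM4 : M ^ 4 = 3 * (Fintype.card K : ℝ) ^ 3 := by
    rw [hM, ← Real.rpow_natCast, ← Real.rpow_mul (by positivity)]
    norm_num
  let G : ZMod p × ZMod p → ℂ := fun s => χ (-(s.1 * i + s.2 * j)) *
    kloostermanSum (traceAddChar p K χ) (algebraMap (ZMod p) K s.1) (algebraMap (ZMod p) K s.2)
  have hG0 : G 0 = (Fintype.card K : ℂ) - 1 := by
    simp [G, kloostermanSum_zero_zero]
  have hG : ∀ s ≠ 0, ‖G s‖ ≤ M := by
    intro s hs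
    rw [norm_mul, AddChar.norm_apply, one_mul]
    refine le_of_pow_le_pow_left₀ four_ne_zero hM0 ?_
    rw [hM4]
    refine norm_kloostermanSum_pow_four_le (traceAddChar_isPrimitive p K hχ) fun h => hs ?_
    exact Prod.ext (by simpa using h.1) (by simpa using h.2)
  have hsum : (p : ℂ) ^ 2 * traceCoTraceCount p K i j - ((Fintype.card K : ℂ) - 1) =
      ∑ s ∈ Finset.univ.erase 0, G s := by
    rw [traceCoTraceCount_eq_sum_kloostermanSum p K hχ, ← hG0, sub_eq_iff_eq_add,
      Finset.sum_erase_add _ _ (Finset.mem_univ _), Fintype.sum_prod_type]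
  have hle : |(p : ℝ) ^ 2 * traceCoTraceCount p K i j - ((Fintype.card K : ℝ) - 1)| ≤
      (p : ℝ) ^ 2 * M := by
    rw [← Real.norm_eq_abs, ← Complex.norm_real]
    push_cast
    rw [hsum]
    refine (norm_sum_le_of_le _ fun s hs => hG s (Finset.ne_of_mem_erase hs)).trans ?_
    rw [Finset.sum_const, nsmul_eq_mul]
    gcongr
    have := (Finset.card_erase_le (s := Finset.univ) (a := (0 : ZMod p × ZMod p)))
    rw [Finset.card_univ, Fintype.card_prod, ZMod.card, ← sq] at this
    exact_mod_cast this
  calc _ ≤ ((p : ℝ) ^ 2 * M) ^ 4 := by gcongr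
    _ = _ := by rw [mul_pow, hM4]; ring

end TraceCount

theorem tendsto_traceCoTraceCount_div (p : ℕ) [Fact p.Prime] (F : ℕ → Type*) [∀ m, Field (F m)]
    [∀ m, Algebra (ZMod p) (F m)] (hF : ∀ m, 1 ≤ m → Nat.card (F m) = p ^ m) (i j : ZMod p) :
    Tendsto (fun m : ℕ => (traceCoTraceCount p (F m) i j : ℝ) / (p : ℝ) ^ m) atTop
      (𝓝 (1 / (p : ℝ) ^ 2)) := by
  have hp : p.Prime := Fact.out
  have hp0 : (0 : ℝ) < p := by exact_mod_cast hp.pos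
  have hq : Tendsto (fun m : ℕ => ((p : ℝ) ^ m)⁻¹) atTop (𝓝 0) :=
    (tendsto_pow_atTop_atTop_of_one_lt (by exact_mod_cast hp.one_lt)).inv_tendsto_atTop
  -- The normalized error: `E m ^ 4 ≤ 3 p⁸ / p^m` for `m ≥ 1`.
  let E : ℕ → ℝ := fun m =>
    ((p : ℝ) ^ 2 * traceCoTraceCount p (F m) i j - ((p : ℝ) ^ m - 1)) / (p : ℝ) ^ m
  have hE4 : Tendsto (fun m => E m ^ 4) atTop (𝓝 0) := by
    refine squeeze_zero' (Eventually.of_forall fun m => by positivity)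
      (g := fun m => (p : ℝ) ^ 8 * 3 * ((p : ℝ) ^ m)⁻¹) ?_ (by simpa using hq.const_mul _)
    filter_upwards [eventually_ge_atTop 1] with m hm
    have hc := hF m hm
    have : Finite (F m) := Nat.finite_of_card_ne_zero (by rw [hc]; exact pow_ne_zero _ hp.ne_zero)
    let _ : Fintype (F m) := Fintype.ofFinite _
    rw [Nat.card_eq_fintype_card] at hc
    have h := abs_traceCoTraceCount_sub_pow_four_le p (F m) i j
    rw [hc, Nat.cast_pow, Even.pow_abs (by decide)] at h
    have hpm : (0 : ℝ) < (p : ℝ) ^ m := by positivity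
    simp only [E]
    rw [div_pow, div_le_iff₀ (by positivity)]
    refine h.trans_eq ?_
    field_simp
  have hE : Tendsto E atTop (𝓝 0) := by
    rw [Metric.tendsto_atTop] at hE4 ⊢
    intro ε hε
    obtain ⟨N, hN⟩ := hE4 (ε ^ 4) (by positivity)
    refine ⟨N, fun n hn => ?_⟩
    have := hN n hn
    rw [Real.dist_0_eq_abs, abs_pow] at this
    rw [Real.dist_0_eq_abs]
    exact lt_of_pow_lt_pow_left₀ 4 hε.le this
  have hlim : Tendsto (fun m => (E m + 1 - ((p : ℝ) ^ m)⁻¹) / (p : ℝ) ^ 2) atTop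
      (𝓝 ((0 + 1 - 0) / (p : ℝ) ^ 2)) := ((hE.add_const 1).sub hq).div_const _
  rw [zero_add, sub_zero] at hlim
  refine hlim.congr fun m => ?_
  simp only [E]
  field_simp
  ring

/-- Here `F m` is, for every `m ≥ 1`, a finite field with `p ^ m` elements. -/
theorem mainTheorem3 (p : ℕ) [Fact p.Prime] (F : ℕ → Type*) [∀ m, Field (F m)]
    [∀ m, Algebra (ZMod p) (F m)] (hF : ∀ m, 1 ≤ m → Nat.card (F m) = p ^ m) :
    Tendsto (fun m : ℕ => (traceCoTraceCount p (F m) 0 0 : ℝ) / (p : ℝ) ^ m) atTop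
        (𝓝 (1 / (p : ℝ) ^ 2)) ∧
      Tendsto (fun m : ℕ => (traceCoTraceCount p (F m) 0 1 : ℝ) / (p : ℝ) ^ m) atTop
        (𝓝 (1 / (p : ℝ) ^ 2)) := by
  exact ⟨tendsto_traceCoTraceCount_div p F hF 0 0, tendsto_traceCoTraceCount_div p F hF 0 1⟩
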